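/- For a commutative ring $A$ and $a\in A$ put $\eta(a)=\begin{pmatrix} a&-1\\1&0\end{pmatrix}$. For $\varepsilon\in A$, a tuple $(c_1,\dots,c_n)\in A^n$ is called an $\varepsilon$-quiddity cycle (of length $n$ over $A$) if $\eta(c_1)\eta(c_2)\cdots\eta(c_n)=\varepsilon\,\mathrm{id}$. For rational $q\neq 1$ and $m\in\mathbb{Z}$ write $[m]_q=\frac{q^m-1}{q-1}$. **Theorem.** Let $R=\mathbb{Z}/p^r\mathbb{Z}$ with $p$ a prime and $r\geq 1$, let $I=pR$, let $n>1$ be an even integer, and let $\varepsilon\in\{1,-1\}\subseteq R$. Let $\omega_n$ be the number of $\varepsilon$-quiddity cycles of length $n$ over $R/I$ (with $\varepsilon$ read modulo $I$), and let $\sigma_n(r)$ be the number of $(-1)^{n/2}$-quiddity cycles of length $n$ over $R$ all of whose entries lie in $I$. Then the number of $\varepsilon$-quiddity cycles of length $n$ over $R$ is $$ \begin{cases} (\omega_n-1)\,p^{(r-1)(n-3)}+\sigma_n(r) & \text{if } \varepsilon=(-1)^{n/2} \text{ in } R,\\ \omega_n\,p^{(r-1)(n-3)} & \text{if } \varepsilon=-(-1)^{n/2}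 \text{ in } R \text{ and } p>2,\\ (\omega_n-1)\,p^{(r-1)(n-3)} & \text{if } \varepsilon=-(-1)^{n/2} \text{ in } R,\ p=2 \text{ and } r\geq 2. \end{cases} $$ (If $p=2$ and $r=1$, then $1=-1$ in $R$ and the first case applies.) Moreover $\sigma_2(r)=1$, $\sigma_4(r)=(r-1)p^r-(r-2)p^{r-1}$, and for even $n>4$ $$ \sigma_n(r)=p^{(n/2-1)r}\,[r-1]_{p^{n/2-2}}-p^{(n/2-1)r-1}\,[r-2]_{p^{n/2-2}} . $$ -/

import Mathlib

/-- The matrix `η(a)` with rows `(a, -1)` and `(1, 0)`. -/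
def eta {R : Type*} [CommRing R] (a : R) : Matrix (Fin 2) (Fin 2) R :=
  !![a, -1; 1, 0]

/-- The ordered product `η(c₁) η(c₂) ⋯ η(cₙ)`. -/
def etaProd {R : Type*} [CommRing R] {n : ℕ} (c : Fin n → R) : Matrix (Fin 2) (Fin 2) R :=
  (List.ofFn fun i => eta (c i)).prod

/-- `c = (c₁, …, cₙ)` is an `ε`-quiddity cycle if `η(c₁) ⋯ η(cₙ) = ε · id`. -/
def IsQuiddityCycle {R : Type*} [CommRing R] {n : ℕ} (ε : R) (c : Fin n → R) : Prop :=
  etaProd c = ε • (1 : Matrix (Fin 2) (Fin 2) R)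

/-- The number of `ε`-quiddity cycles of length `n` over `R`. -/
noncomputable def quiddityCount (R : Type*) [CommRing R] (n : ℕ) (ε : R) : ℕ :=
  Nat.card {c : Fin n → R // IsQuiddityCycle ε c}

/-- The number of `ε`-quiddity cycles of length `n` over `R` all of whose entries lie in `I`. -/
noncomputable def quiddityCountIn {R : Type*} [CommRing R] (I : Ideal R) (n : ℕ) (ε : R) : ℕ :=
  Nat.card {c : Fin n → R // IsQuiddityCycle ε c ∧ ∀ i, c i ∈ I}

/-- The ideal `I = pR` of `R = ℤ/p^r ℤ`. -/
def primeIdeal (p r : ℕ) : Ideal (ZMod (p ^ r)) :=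
  Ideal.span {(p : ZMod (p ^ r))}

/-- The number `ωₙ` of `ε`-quiddity cycles of length `n` over the residue ring `R/I`, where
`R = ℤ/p^r ℤ`, `I = pR`, and `ε ∈ R` is read modulo `I`. -/
noncomputable def omegaCount (p r n : ℕ) (ε : ZMod (p ^ r)) : ℕ :=
  quiddityCount (ZMod (p ^ r) ⧸ primeIdeal p r) n (Ideal.Quotient.mk (primeIdeal p r) ε)

/-- The number `σₙ(r)` of `(-1)^{n/2}`-quiddity cycles of length `n` over `R = ℤ/p^r ℤ`
all of whose entries lie in `I = pR`. -/
noncomputable def sigmaCount (p r n : ℕ) : ℕ :=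
  quiddityCountIn (primeIdeal p r) n ((-1) ^ (n / 2))

/-- The `q`-number `[m]_q = (q^m - 1) / (q - 1)` for an integer `m` and `q ≠ 1`. -/
def qNumber (q : ℚ) (m : ℤ) : ℚ :=
  (q ^ m - 1) / (q - 1)

/-! Sort the cycles over `R` by their reduction `b` modulo `I`.

If `b ≠ 0`, some entry of every lift is a unit. Being a cycle is invariant under rotation, so this
entry may be put second. In η(x)η(y)η(z)M = ε·id with `y` a unit, `M` determines x, y, z
(`eta_mul_eta_mul_eta_mul_eq_iff`). The other n - 3 entries can therefore be lifted arbitrarily, and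
`b` has exactly |I|^(n-3) = p^((r-1)(n-3)) lifts (`liftCount_of_ne_zero`).

The lifts of `b = 0` are the cycles with entries in `I`. For n = 2(m+1), peeling off two factors at
a time turns their number into that of solutions of ∑ xᵢyᵢ = (-1)^(m+1) ε - 1 in I^m × I^m
(`quiddityCountIn_eq_hyperbolicCount`). If ε = -(-1)^(n/2), the right side is -2, and there is no
solution because the left side lies in I². If ε = (-1)^(n/2), the right side is 0. Dividing all
coordinates by `p` leaves a count of orthogonal pairs over ℤ/p^(r-2), which satisfies a recursion
(`orthogonalCount_succ`) solved by geometric sums.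

The -1 next to ω accounts for the zero tuple, which is a cycle over R/I exactly when ε = (-1)^(n/2)
modulo `I`. -/

theorem Nat.card_subtype_comp_of_surjective {A B : Type*} [AddGroup A] [AddGroup B] [Finite A]
    (f : A →+ B) (hf : Function.Surjective f) (P : B → Prop) :
    Nat.card {a // P (f a)} = Nat.card f.ker * Nat.card {b // P b} := by
  have : Finite B := Finite.of_surjective f hf
  have e : {a // P (f a)} ≃ Σ b : {b // P b}, {a // f a = b} :=
    { toFun := fun a => ⟨⟨f a, a.2⟩, ⟨a, rfl⟩⟩
      invFun := fun s => ⟨s.2.1, by rw [s.2.2]; exact s.1.2⟩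
      left_inv := fun _ => rfl
      right_inv := by rintro ⟨⟨b, hb⟩, ⟨a, ha⟩⟩; simp only at ha; subst ha; rfl }
  have h : ∀ b : B, Nat.card {a // f a = b} = Nat.card f.ker := fun b =>
    Nat.card_congr (f.fiberEquivKerOfSurjective hf b)
  have := Fintype.ofFinite {b // P b}
  rw [Nat.card_congr e, Nat.card_sigma]
  simp [h, mul_comm]

/-! ### Products of the matrices η(a). -/

section EtaProd

variable {A : Type*} [CommRing A]

theorem etaProd_cons {n : ℕ} (a : A) (c : Fin n → A) :
    etaProd (Fin.cons a c : Fin (n + 1) → A) = eta a * etaProd c := by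
  simp [etaProd, List.ofFn_succ]

theorem etaProd_succ {n : ℕ} (c : Fin (n + 1) → A) :
    etaProd c = eta (c 0) * etaProd (Fin.tail c) := by
  conv_lhs => rw [← Fin.cons_self_tail c, etaProd_cons]

theorem det_eta (a : A) : (eta a).det = 1 := by
  simp [eta, Matrix.det_fin_two]

theorem det_etaProd {n : ℕ} (c : Fin n → A) : (etaProd c).det = 1 := by
  induction n with
  | zero => simp [etaProd]
  | succ n ih => rw [etaProd_succ, Matrix.det_mul, det_eta, ih, one_mul]

theorem etaProd_snoc {n : ℕ} (c : Fin n → A) (a : A) :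
    etaProd (Fin.snoc c a : Fin (n + 1) → A) = etaProd c * eta a := by
  rw [etaProd, List.ofFn_succ']; simp [etaProd]

theorem etaProd_map {B : Type*} [CommRing B] (f : A →+* B) {n : ℕ} (c : Fin n → A) :
    etaProd (fun i => f (c i)) = (etaProd c).map f := by
  induction n with
  | zero => simp [etaProd]
  | succ n ih =>
    have h := ih (Fin.tail c)
    rw [etaProd_succ, etaProd_succ c, Matrix.map_mul, ← h]
    congr 1
    ext i j; fin_cases i <;> fin_cases j <;> simp [eta]

theorem IsQuiddityCycle.map {B : Type*} [CommRing B] (f : A →+* B) {n : ℕ} {c : Fin n → A} {ε : A}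
    (h : IsQuiddityCycle ε c) : IsQuiddityCycle (f ε) (fun i => f (c i)) := by
  rw [IsQuiddityCycle, etaProd_map, h]
  ext i j; fin_cases i <;> fin_cases j <;> simp

theorem etaProd_zero (k : ℕ) :
    etaProd (0 : Fin (2 * k) → A) = (-1 : A) ^ k • (1 : Matrix (Fin 2) (Fin 2) A) := by
  have h : eta (0 : A) ^ 2 = -1 := by
    ext i j; fin_cases i <;> fin_cases j <;> simp [eta, pow_two]
  simp only [etaProd, Pi.zero_apply, List.ofFn_const, List.prod_replicate, pow_mul, h]
  rcases Nat.even_or_odd k with hk | hk <;> simp [hk.neg_one_pow]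

/-- Since ε² = 1, the matrix εM is a one-sided inverse of `N`, hence a two-sided one. -/
theorem Matrix.mul_eq_smul_one_comm {ε : A} (hε : ε * ε = 1) {M N : Matrix (Fin 2) (Fin 2) A}
    (h : M * N = ε • 1) : N * M = ε • 1 := by
  have h1 : (ε • M) * N = 1 := by rw [Matrix.smul_mul, h, smul_smul, hε, one_smul]
  have h2 := mul_eq_one_comm.mp h1
  rw [Matrix.mul_smul] at h2
  rw [← h2, smul_smul, hε, one_smul]

theorem etaProd_comp_finRotate {n : ℕ} (c : Fin (n + 1) → A) :
    etaProd (c ∘ finRotate (n + 1)) = etaProd (Fin.tail c) * eta (c 0) := by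
  rw [← etaProd_snoc]
  congr 1
  ext i
  refine Fin.lastCases ?_ (fun j => ?_) i
  · simp
  · simp [Fin.tail, finRotate_apply]

theorem isQuiddityCycle_comp_finRotate {ε : A} (hε : ε * ε = 1) {n : ℕ} (c : Fin (n + 1) → A) :
    IsQuiddityCycle ε (c ∘ finRotate (n + 1)) ↔ IsQuiddityCycle ε c := by
  rw [IsQuiddityCycle, IsQuiddityCycle, etaProd_comp_finRotate, etaProd_succ c]
  exact ⟨Matrix.mul_eq_smul_one_comm hε, Matrix.mul_eq_smul_one_comm hε⟩

/-- The matrix equation has four entries, but both sides have determinant 1 and `y` is invertible,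
so three conditions suffice. They give `y` from `M`, and then `x` and `z` by division by `y`. -/
theorem eta_mul_eta_mul_eta_mul_eq_iff {ε : A} (hε : ε * ε = 1) {y : A} (hy : IsUnit y) (x z : A)
    {M : Matrix (Fin 2) (Fin 2) A} (hM : M.det = 1) :
    eta x * (eta y * (eta z * M)) = ε • 1 ↔
      y = -(ε * M 0 0) ∧ x * y = 1 + ε * M 0 1 ∧ y * z = 1 - ε * M 1 0 := by
  obtain ⟨a, b, c, d, rfl⟩ : ∃ a b c d, M = !![a, b; c, d] := ⟨_, _, _, _, Matrix.eta_fin_two M⟩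
  rw [Matrix.det_fin_two_of] at hM
  obtain ⟨w, hw⟩ := hy.exists_right_inv
  have hr : ε • (1 : Matrix (Fin 2) (Fin 2) A) = !![ε, 0; 0, ε] := by
    ext i j; fin_cases i <;> fin_cases j <;> simp
  rw [hr]
  simp only [eta, Matrix.mul_fin_two, EmbeddingLike.apply_eq_iff_eq, Matrix.vecCons_inj,
    Matrix.of_apply, Matrix.cons_val', Matrix.cons_val_zero, Matrix.cons_val_one,
    Matrix.cons_val_fin_one, and_true]
  constructor
  · rintro ⟨⟨h00, h01⟩, h10, h11⟩
    refine ⟨?_, ?_, ?_⟩ <;> grind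
  · rintro ⟨h1, h2, h3⟩
    refine ⟨⟨?_, ?_⟩, ?_, ?_⟩ <;> grind

end EtaProd

/-! ### Lifting nonzero cycles from R/I to R. -/

section Lifting

variable {R : Type*} [CommRing R] {I : Ideal R}

/-- The number of cycles over `R` that reduce to a given tuple over `R ⧸ I`. -/
noncomputable def liftCount (ε : R) {n : ℕ} (b : Fin n → R ⧸ I) : ℕ :=
  Nat.card {c : Fin n → R // IsQuiddityCycle ε c ∧ (fun i => Ideal.Quotient.mk I (c i)) = b}

theorem liftCount_comp_finRotate {ε : R} (hε : ε * ε = 1) {n : ℕ} (b : Fin (n + 1) → R ⧸ I) :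
    liftCount ε (b ∘ finRotate (n + 1)) = liftCount ε b := by
  refine (Nat.card_congr (Equiv.subtypeEquiv
    (Equiv.arrowCongr (finRotate (n + 1)).symm (Equiv.refl R)) fun c => ?_)).symm
  have : (Equiv.arrowCongr (finRotate (n + 1)).symm (Equiv.refl R)) c = c ∘ finRotate (n + 1) := rfl
  rw [this, isQuiddityCycle_comp_finRotate hε]
  refine and_congr_right fun _ => ?_
  exact ((finRotate (n + 1)).surjective.injective_comp_right.eq_iff
    (a := fun i => Ideal.Quotient.mk I (c i)) (b := b)).symm

theorem card_mk_comp_eq [Finite R] (m : ℕ) (b : Fin m → R ⧸ I) :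
    Nat.card {c : Fin m → R // (fun i => Ideal.Quotient.mk I (c i)) = b} = Nat.card I ^ m := by
  let e : {c : Fin m → R // (fun i => Ideal.Quotient.mk I (c i)) = b} ≃
      (∀ i, {x : R // Ideal.Quotient.mk I x = b i}) :=
    { toFun := fun c i => ⟨c.1 i, congrFun c.2 i⟩
      invFun := fun c => ⟨fun i => c i, funext fun i => (c i).2⟩
      left_inv := fun _ => rfl
      right_inv := fun _ => rfl }
  have h : ∀ i, Nat.card {x : R // Ideal.Quotient.mk I x = b i} = Nat.card I := by
    intro i
    have := Nat.card_subtype_comp_of_surjective (Ideal.Quotient.mk I).toAddMonoidHom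
      Ideal.Quotient.mk_surjective (fun y => y = b i)
    simp only [RingHom.toAddMonoidHom_eq_coe, AddMonoidHom.coe_coe, Nat.card_unique, mul_one] at this
    rw [this]
    refine Nat.card_congr (Equiv.subtypeEquivRight fun x => ?_)
    simp [AddMonoidHom.mem_ker, Ideal.Quotient.eq_zero_iff_mem]
  rw [Nat.card_congr e, Nat.card_pi]
  simp [h]

/-- Lifts of `b` correspond to arbitrary lifts of its entries from index 3 on: the entry at index 1
is a unit, so the first three entries are determined by the others. -/
theorem liftCount_of_apply_one_ne_zero [Finite R] (hI : ∀ x, x ∉ I → IsUnit x) {ε : R} (hε : ε * ε = 1) {m : ℕ}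
    {b : Fin (m + 3) → R ⧸ I} (hb : IsQuiddityCycle (Ideal.Quotient.mk I ε) b) (hb1 : b 1 ≠ 0) :
    liftCount ε b = Nat.card I ^ m := by
  rw [← card_mk_comp_eq m (Fin.tail (Fin.tail (Fin.tail b)))]
  have hunit : ∀ y, Ideal.Quotient.mk I y = b 1 → IsUnit y := fun y hy =>
    hI y fun h => hb1 (by rw [← hy, Ideal.Quotient.eq_zero_iff_mem.mpr h])
  have key : ∀ c : Fin (m + 3) → R, IsUnit (c 1) → (IsQuiddityCycle ε c ↔
      c 1 = -(ε * etaProd (Fin.tail (Fin.tail (Fin.tail c))) 0 0) ∧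
      c 0 * c 1 = 1 + ε * etaProd (Fin.tail (Fin.tail (Fin.tail c))) 0 1 ∧
      c 1 * c 2 = 1 - ε * etaProd (Fin.tail (Fin.tail (Fin.tail c))) 1 0) := by
    intro c hc
    rw [IsQuiddityCycle, etaProd_succ, etaProd_succ (Fin.tail c), etaProd_succ (Fin.tail (Fin.tail c))]
    exact eta_mul_eta_mul_eta_mul_eq_iff hε hc _ _ (det_etaProd _)
  have hε' : Ideal.Quotient.mk I ε * Ideal.Quotient.mk I ε = 1 := by rw [← map_mul, hε, map_one]
  have hu1 : IsUnit (b 1) := by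
    obtain ⟨y, hy⟩ := Ideal.Quotient.mk_surjective (b 1)
    rw [← hy]; exact (hunit y hy).map _
  have keyb : b 1 = -(Ideal.Quotient.mk I ε * etaProd (Fin.tail (Fin.tail (Fin.tail b))) 0 0) ∧
      b 0 * b 1 = 1 + Ideal.Quotient.mk I ε * etaProd (Fin.tail (Fin.tail (Fin.tail b))) 0 1 ∧
      b 1 * b 2 = 1 - Ideal.Quotient.mk I ε * etaProd (Fin.tail (Fin.tail (Fin.tail b))) 1 0 := by
    rw [IsQuiddityCycle, etaProd_succ, etaProd_succ (Fin.tail b),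
      etaProd_succ (Fin.tail (Fin.tail b))] at hb
    exact (eta_mul_eta_mul_eta_mul_eq_iff hε' hu1 _ _ (det_etaProd _)).mp hb
  refine Nat.card_congr (Equiv.ofBijective
    (fun c => ⟨Fin.tail (Fin.tail (Fin.tail c.1)), funext fun i => congrFun c.2.2 i.succ.succ.succ⟩) ⟨?_, ?_⟩)
  · rintro ⟨c, hc, hcb⟩ ⟨c', hc', hcb'⟩ h
    have ht : Fin.tail (Fin.tail (Fin.tail c)) = Fin.tail (Fin.tail (Fin.tail c')) :=
      congrArg Subtype.val h
    have hu := hunit (c 1) (congrFun hcb 1)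
    have hu' := hunit (c' 1) (congrFun hcb' 1)
    obtain ⟨h1, h2, h3⟩ := (key c hu).mp hc
    obtain ⟨h1', h2', h3'⟩ := (key c' hu').mp hc'
    rw [ht] at h1 h2 h3
    have e1 : c 1 = c' 1 := h1.trans h1'.symm
    have e0 : c 0 = c' 0 := hu.mul_right_cancel (by rw [h2, e1, h2'])
    have e2 : c 2 = c' 2 := hu.mul_left_cancel (by rw [h3, e1, h3'])
    refine Subtype.ext (funext fun i => ?_)
    refine Fin.cases e0 (fun i => Fin.cases e1 (fun i => Fin.cases e2 (fun i => ?_) i) i) i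
    exact congrFun ht i
  · rintro ⟨t, ht⟩
    have htM : (etaProd t).map (Ideal.Quotient.mk I) = etaProd (Fin.tail (Fin.tail (Fin.tail b))) := by
      rw [← etaProd_map, ht]
    obtain ⟨b1, b2, b3⟩ := keyb
    rw [← htM] at b1 b2 b3
    simp only [Matrix.map_apply] at b1 b2 b3
    have hyb : Ideal.Quotient.mk I (-(ε * etaProd t 0 0)) = b 1 := by rw [b1]; simp
    obtain ⟨w, hw⟩ := (hunit _ hyb).exists_right_inv
    set y := -(ε * etaProd t 0 0) with hy
    -- The first three entries are forced by `key`, with `w` the inverse of `y`. The same equations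
    -- modulo `I` show that they reduce to the entries of `b`.
    let c : Fin (m + 3) → R := Fin.cons (w * (1 + ε * etaProd t 0 1))
      (Fin.cons y (Fin.cons (w * (1 - ε * etaProd t 1 0)) t))
    have hc1 : c 1 = y := rfl
    have hc0 : c 0 = w * (1 + ε * etaProd t 0 1) := rfl
    have hc2 : c 2 = w * (1 - ε * etaProd t 1 0) := rfl
    have htail : Fin.tail (Fin.tail (Fin.tail c)) = t := rfl
    refine ⟨⟨c, (key c ?_).mpr ?_, ?_⟩, rfl⟩
    · rw [hc1]; exact hunit y hyb
    · rw [htail, hc1, hc0, hc2]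
      exact ⟨rfl, by linear_combination (1 + ε * etaProd t 0 1) * hw,
        by linear_combination (1 - ε * etaProd t 1 0) * hw⟩
    · have e1 : Ideal.Quotient.mk I (c 1) = b 1 := hyb
      have e0 : Ideal.Quotient.mk I (c 0) = b 0 := hu1.mul_right_cancel <| by
        rw [b2, ← hyb, ← map_mul, hc0,
          show w * (1 + ε * etaProd t 0 1) * y = 1 + ε * etaProd t 0 1 by
            linear_combination (1 + ε * etaProd t 0 1) * hw]
        simp
      have e2 : Ideal.Quotient.mk I (c 2) = b 2 := hu1.mul_left_cancel <| by
        rw [b3, ← hyb, ← map_mul, hc2,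
          show y * (w * (1 - ε * etaProd t 1 0)) = 1 - ε * etaProd t 1 0 by
            linear_combination (1 - ε * etaProd t 1 0) * hw]
        simp
      funext i
      refine Fin.cases e0 (fun i => Fin.cases e1 (fun i => Fin.cases e2 (fun i => ?_) i) i) i
      exact congrFun ht i

theorem liftCount_of_ne_zero [Finite R] (hI : ∀ x, x ∉ I → IsUnit x) {ε : R} (hε : ε * ε = 1) {m : ℕ}
    {b : Fin (m + 3) → R ⧸ I} (hb : IsQuiddityCycle (Ideal.Quotient.mk I ε) b) (hb0 : b ≠ 0) :
    liftCount ε b = Nat.card I ^ m := by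
  have hε' : Ideal.Quotient.mk I ε * Ideal.Quotient.mk I ε = 1 := by rw [← map_mul, hε, map_one]
  obtain ⟨i, hi⟩ := Function.ne_iff.mp hb0
  -- Induction on the number of rotations that bring a nonzero entry to index 1; one always exists
  -- because `finRotate` is a single cycle through all indices.
  have main : ∀ (j : ℕ) (b : Fin (m + 3) → R ⧸ I), IsQuiddityCycle (Ideal.Quotient.mk I ε) b →
      b (((finRotate (m + 3)) ^ j) 1) ≠ 0 → liftCount ε b = Nat.card I ^ m := by
    intro j
    induction j with
    | zero => exact fun b hb h => liftCount_of_apply_one_ne_zero hI hε hb h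
    | succ j ih =>
      intro b hb h
      rw [← liftCount_comp_finRotate hε]
      refine ih _ ((isQuiddityCycle_comp_finRotate hε' b).mpr hb) ?_
      rw [pow_succ'] at h
      exact h
  have hmove : ∀ j : Fin (m + 3), finRotate (m + 3) j ≠ j := fun j => by
    have : j ∈ (finRotate (m + 3)).support := by rw [support_finRotate]; simp
    exact Equiv.Perm.mem_support.mp this
  obtain ⟨j, hj⟩ := isCycle_finRotate.exists_pow_eq (hmove 1) (hmove i)
  exact main j b hb (by rw [hj]; exact hi)

theorem quiddityCount_eq [Finite R] (hI : ∀ x, x ∉ I → IsUnit x) {ε : R} (hε : ε * ε = 1) (m : ℕ) :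
    quiddityCount R (m + 3) ε =
      Nat.card {b : Fin (m + 3) → R ⧸ I // IsQuiddityCycle (Ideal.Quotient.mk I ε) b ∧ b ≠ 0} *
        Nat.card I ^ m + quiddityCountIn I (m + 3) ε := by
  classical
  have := Fintype.ofFinite R
  have := Fintype.ofFinite (R ⧸ I)
  have e : {c : Fin (m + 3) → R // IsQuiddityCycle ε c} ≃ Σ b : Fin (m + 3) → R ⧸ I,
      {c : Fin (m + 3) → R // IsQuiddityCycle ε c ∧ (fun i => Ideal.Quotient.mk I (c i)) = b} :=
    { toFun := fun c => ⟨_, ⟨c.1, c.2, rfl⟩⟩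
      invFun := fun s => ⟨s.2.1, s.2.2.1⟩
      left_inv := fun _ => rfl
      right_inv := by rintro ⟨b, ⟨c, hc, rfl⟩⟩; rfl }
  have h0 : liftCount ε (0 : Fin (m + 3) → R ⧸ I) = quiddityCountIn I (m + 3) ε := by
    refine Nat.card_congr (Equiv.subtypeEquivRight fun c => and_congr_right fun _ => ?_)
    simp [funext_iff, Ideal.Quotient.eq_zero_iff_mem]
  have h1 : ∀ b : Fin (m + 3) → R ⧸ I, liftCount ε b =
      (if IsQuiddityCycle (Ideal.Quotient.mk I ε) b ∧ b ≠ 0 then Nat.card I ^ m else 0) +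
      (if b = 0 then quiddityCountIn I (m + 3) ε else 0) := by
    intro b
    by_cases hb0 : b = 0
    · subst hb0; simp [h0]
    · by_cases hb : IsQuiddityCycle (Ideal.Quotient.mk I ε) b
      · simp [hb, hb0, liftCount_of_ne_zero hI hε hb hb0]
      · simp only [hb, hb0, false_and, if_false, add_zero]
        refine Nat.card_eq_zero.mpr (Or.inl ⟨?_⟩)
        rintro ⟨c, hc, rfl⟩
        exact hb (hc.map _)
  rw [quiddityCount, Nat.card_congr e, Nat.card_sigma]
  refine (Finset.sum_congr rfl fun b _ => h1 b).trans ?_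
  rw [Finset.sum_add_distrib, Finset.sum_ite_eq' , ← Finset.sum_filter, Finset.sum_const,
    Nat.card_eq_fintype_card (α := {b : Fin (m + 3) → R ⧸ I // _}), Fintype.card_subtype]
  simp

end Lifting

/-! ### Cycles with all entries in I and the equation ∑ xᵢyᵢ = t. -/

section Alternating

variable {R : Type*} [CommRing R] {I : Ideal R}

/-- The number of pairs `(x, y)` of vectors in `Iᵐ` with `∑ xᵢ yᵢ = t`. -/
noncomputable def hyperbolicCount (I : Ideal R) (m : ℕ) (t : R) : ℕ :=
  Nat.card {v : Fin m → I × I // ∑ i, ((v i).1 : R) * (v i).2 = t}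

theorem hyperbolicCount_succ [Fintype I] (m : ℕ) (t : R) :
    hyperbolicCount I (m + 1) t = ∑ v : I × I, hyperbolicCount I m (t - v.1 * v.2) := by
  have e : {v : Fin (m + 1) → I × I // ∑ i, ((v i).1 : R) * (v i).2 = t} ≃
      Σ w : I × I, {v : Fin m → I × I // ∑ i, ((v i).1 : R) * (v i).2 = t - w.1 * w.2} :=
    { toFun := fun v => ⟨v.1 0, ⟨Fin.tail v.1, by
        have := v.2; rw [Fin.sum_univ_succ] at this; exact eq_sub_of_add_eq' this⟩⟩
      invFun := fun s => ⟨Fin.cons s.1 s.2.1, by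
        rw [Fin.sum_univ_succ]; simp [s.2.2]⟩
      left_inv := fun v => by simp
      right_inv := fun s => rfl }
  rw [hyperbolicCount, Nat.card_congr e, Nat.card_sigma]
  rfl

/-- The number of tuples in `Iⁿ` with a given value of `etaProd`. -/
noncomputable def etaProdCount (I : Ideal R) (n : ℕ) (g : Matrix (Fin 2) (Fin 2) R) : ℕ :=
  Nat.card {c : Fin n → I // etaProd (fun i => (c i : R)) = g}

/-- The inverse of `eta a`. -/
def etaInv (a : R) : Matrix (Fin 2) (Fin 2) R := !![0, 1; -1, a]

theorem etaInv_mul (a : R) (M : Matrix (Fin 2) (Fin 2) R) :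
    etaInv a * M = !![M 1 0, M 1 1; -M 0 0 + a * M 1 0, -M 0 1 + a * M 1 1] := by
  conv_lhs => rw [Matrix.eta_fin_two M, etaInv, Matrix.mul_fin_two]
  simp

theorem det_etaInv (a : R) : (etaInv a).det = 1 := by simp [etaInv, Matrix.det_fin_two]

theorem etaInv_mul_eta (a : R) : etaInv a * eta a = 1 := by
  ext i j; fin_cases i <;> fin_cases j <;> simp [eta, etaInv]

theorem eta_mul_etaInv (a : R) : eta a * etaInv a = 1 :=
  mul_eq_one_comm.mp (etaInv_mul_eta a)

theorem eta_mul_eq_iff (a : R) (M g : Matrix (Fin 2) (Fin 2) R) :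
    eta a * M = g ↔ M = etaInv a * g := by
  constructor
  · rintro rfl; rw [← mul_assoc, etaInv_mul_eta, one_mul]
  · rintro rfl; rw [← mul_assoc, eta_mul_etaInv, one_mul]

theorem etaProdCount_add_two [Fintype I] (n : ℕ) (g : Matrix (Fin 2) (Fin 2) R) :
    etaProdCount I (n + 2) g =
      ∑ v : I × I, etaProdCount I n (etaInv (v.2 : R) * (etaInv (v.1 : R) * g)) := by
  have key : ∀ (a b : I) (c : Fin n → I),
      etaProd (fun i => ((Fin.cons a (Fin.cons b c : Fin (n + 1) → I) : Fin (n + 2) → I) i : R)) = g ↔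
      etaProd (fun i => (c i : R)) = etaInv (b : R) * (etaInv (a : R) * g) := by
    intro a b c
    rw [etaProd_succ, etaProd_succ, ← eta_mul_eq_iff, ← eta_mul_eq_iff]
    rfl
  have hcons : ∀ c : Fin (n + 2) → I,
      c = Fin.cons (c 0) (Fin.cons (c 1) (Fin.tail (Fin.tail c)) : Fin (n + 1) → I) := fun c =>
    funext fun i => Fin.cases rfl (fun i => Fin.cases rfl (fun i => rfl) i) i
  have e : {c : Fin (n + 2) → I // etaProd (fun i => (c i : R)) = g} ≃ Σ v : I × I,
      {c : Fin n → I // etaProd (fun i => (c i : R)) = etaInv (v.2 : R) * (etaInv (v.1 : R) * g)} :=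
    { toFun := fun c => ⟨(c.1 0, c.1 1), ⟨Fin.tail (Fin.tail c.1), (key _ _ _).mp (by
        simp only [← hcons]; exact c.2)⟩⟩
      invFun := fun s => ⟨Fin.cons s.1.1 (Fin.cons s.1.2 s.2.1), (key _ _ _).mpr s.2.2⟩
      left_inv := fun c => Subtype.ext (hcons c.1).symm
      right_inv := fun s => rfl }
  rw [etaProdCount, Nat.card_congr e, Nat.card_sigma]
  rfl

/-- The induction needs a general target `g`, since removing two factors changes it. Determinant 1
and off-diagonal entries in `I` persist, and only the entry `g 1 1` affects the count. Removing
η(a)η(b) replaces it by -g₁₁ - (g₀₁ - a g₁₁) b, so up to sign the new summand is the product of g₀₁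
- a g₁₁ and `b`. -/
theorem etaProdCount_eq_hyperbolicCount [Finite R] (hI : ∀ x ∈ I, IsUnit (1 + x)) (m : ℕ) :
    ∀ g : Matrix (Fin 2) (Fin 2) R, g.det = 1 → g 0 1 ∈ I → g 1 0 ∈ I →
      etaProdCount I (2 * (m + 1)) g = hyperbolicCount I m ((-1) ^ (m + 1) * g 1 1 - 1) := by
  have := Fintype.ofFinite I
  induction m with
  | zero =>
    intro g hg h01 h10
    classical
    rw [Matrix.det_fin_two] at hg
    have hH : ∀ t : R, hyperbolicCount I 0 t = if t = 0 then 1 else 0 := by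
      intro t
      split_ifs with ht
      · subst ht; simp [hyperbolicCount]
      · simp [hyperbolicCount, Ne.symm ht]
    rw [hH]
    have hP : ∀ c : Fin 2 → I, etaProd (fun i => (c i : R)) = !![(c 0 : R) * c 1 - 1, -(c 0 : R); c 1, -1] := by
      intro c
      simp [etaProd, eta, List.ofFn_succ, sub_eq_add_neg]
    change Nat.card {c : Fin 2 → I // etaProd (fun i => (c i : R)) = g} = _
    simp only [hP]
    split_ifs with h
    · have h11 : g 1 1 = -1 := by simp at h; linear_combination -h
      rw [Nat.card_eq_one_iff_unique]
      refine ⟨⟨?_⟩, ⟨⟨![⟨-g 0 1, I.neg_mem h01⟩, ⟨g 1 0, h10⟩], ?_⟩⟩⟩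
      · rintro ⟨c, hc⟩ ⟨c', hc'⟩
        rw [← hc'] at hc
        have e0 := congrFun (congrFun hc 0) 1
        have e1 := congrFun (congrFun hc 1) 0
        simp at e0 e1
        refine Subtype.ext (funext fun i => ?_)
        fin_cases i
        · exact e0
        · exact e1
      · ext i j
        fin_cases i <;> fin_cases j <;> simp [h11]
        rw [h11] at hg; linear_combination hg
    · refine Nat.card_eq_zero.mpr (Or.inl ⟨?_⟩)
      rintro ⟨c, rfl⟩
      simp at h
  | succ m ih =>
    intro g hg h01 h10
    rw [show 2 * (m + 1 + 1) = 2 * (m + 1) + 2 by ring, etaProdCount_add_two, hyperbolicCount_succ]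
    -- The determinant gives g₀₀ g₁₁ = 1 + g₀₁ g₁₀, a unit. Hence a ↦ g₀₁ - a g₁₁ permutes `I`,
    -- which yields the substitution `e`.
    have hu : IsUnit (g 1 1) := by
      rw [Matrix.det_fin_two] at hg
      have := hI _ (I.mul_mem_left (g 0 1) h10)
      rw [show 1 + g 0 1 * g 1 0 = g 0 0 * g 1 1 by linear_combination -hg] at this
      exact isUnit_of_mul_isUnit_right this
    obtain ⟨w, hw⟩ := hu.exists_right_inv
    have hs : (-1 : R) ^ (m + 1) * (-1) ^ (m + 1) = 1 := by rw [← mul_pow]; simp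
    let e : I × I ≃ I × I :=
      { toFun := fun v => (⟨(-1) ^ (m + 1) * (g 0 1 - v.1 * g 1 1),
          I.mul_mem_left _ (I.sub_mem h01 (I.mul_mem_right _ v.1.2))⟩, v.2)
        invFun := fun v => (⟨w * (g 0 1 - (-1) ^ (m + 1) * v.1),
          I.mul_mem_left _ (I.sub_mem h01 (I.mul_mem_left _ v.1.2))⟩, v.2)
        left_inv := by
          rintro ⟨a, b⟩
          refine Prod.ext (Subtype.ext ?_) rfl
          simp only
          linear_combination (a : R) * hw - w * (g 0 1 - a * g 1 1) * hs
        right_inv := by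
          rintro ⟨a, b⟩
          refine Prod.ext (Subtype.ext ?_) rfl
          simp only
          linear_combination (-1) ^ (m + 1) * ((-1) ^ (m + 1) * a - g 0 1) * hw + a * hs }
    refine Fintype.sum_equiv e _ _ ?_
    rintro ⟨a, b⟩
    rw [ih]
    · congr 1
      simp only [e, etaInv_mul, Matrix.of_apply, Matrix.cons_val', Matrix.cons_val_zero,
        Matrix.cons_val_one, Matrix.cons_val_fin_one, Equiv.coe_fn_mk]
      ring
    · rw [Matrix.det_mul, Matrix.det_mul, det_etaInv, det_etaInv, hg, one_mul, one_mul]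
    · rw [etaInv_mul, etaInv_mul]
      simpa using I.add_mem (I.neg_mem h01) (I.mul_mem_right _ a.2)
    · rw [etaInv_mul, etaInv_mul]
      simpa using I.add_mem (I.neg_mem h10) (I.mul_mem_right _ b.2)

theorem quiddityCountIn_eq_hyperbolicCount [Finite R] (hI : ∀ x ∈ I, IsUnit (1 + x)) (m : ℕ) {ε : R}
    (hε : ε * ε = 1) :
    quiddityCountIn I (2 * (m + 1)) ε = hyperbolicCount I m ((-1) ^ (m + 1) * ε - 1) := by
  have := etaProdCount_eq_hyperbolicCount hI m (ε • 1) (by simp [pow_two, hε]) (by simp) (by simp)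
  simp only [Matrix.smul_apply, Matrix.one_apply_eq, smul_eq_mul, mul_one] at this
  rw [← this]
  refine Nat.card_congr
    { toFun := fun c => ⟨fun i => ⟨c.1 i, c.2.2 i⟩, c.2.1⟩
      invFun := fun c => ⟨fun i => c.1 i, c.2, fun i => (c.1 i).2⟩
      left_inv := fun _ => rfl
      right_inv := fun _ => rfl }

end Alternating

/-! ### Division-free fibre counting along surjective homomorphisms. -/

theorem Nat.card_subtype_comp_mul_card {A B : Type*} [AddGroup A] [AddGroup B] [Finite A]
    (f : A →+ B) (hf : Function.Surjective f) (P : B → Prop) :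
    Nat.card {a // P (f a)} * Nat.card B = Nat.card A * Nat.card {b // P b} := by
  have h := Nat.card_subtype_comp_of_surjective f hf fun _ => True
  rw [Nat.card_subtype_comp_of_surjective f hf P]
  simp only [Nat.card_subtype_true] at h
  rw [h]; ring

section PairVectors

/-- The coordinatewise extension of two homomorphisms to vectors of pairs. -/
def pairVecMap {A B C D : Type*} [AddCommGroup A] [AddCommGroup B] [AddCommGroup C] [AddCommGroup D]
    (f : A →+ B) (g : C →+ D) (m : ℕ) : (Fin m → A × C) →+ (Fin m → B × D) :=
  (f.prodMap g).compLeft (Fin m)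

theorem card_subtype_pairVecMap {A B C D : Type*} [AddCommGroup A] [AddCommGroup B] [AddCommGroup C]
    [AddCommGroup D] [Finite A] [Finite C] {f : A →+ B} {g : C →+ D} (hf : Function.Surjective f)
    (hg : Function.Surjective g) (m : ℕ) (P : (Fin m → B × D) → Prop) :
    Nat.card {v // P (pairVecMap f g m v)} * (Nat.card B * Nat.card D) ^ m =
      (Nat.card A * Nat.card C) ^ m * Nat.card {v // P v} := by
  have h := Nat.card_subtype_comp_mul_card (pairVecMap f g m)
    ((hf.prodMap hg).comp_left (α := Fin m)) P
  simpa [Nat.card_fun, Nat.card_prod] using h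

end PairVectors

/-! ### Orthogonal pairs of vectors over ℤ/p^s. -/

section PrimePower

variable {p : ℕ} [hp : Fact p.Prime]

theorem ZMod.pow_mul_eq_zero_iff (s k : ℕ) (t : ZMod (p ^ (s + k))) :
    (p : ZMod (p ^ (s + k))) ^ k * t = 0 ↔
      ZMod.castHom (pow_dvd_pow p (Nat.le_add_right s k)) (ZMod (p ^ s)) t = 0 := by
  obtain ⟨t, rfl⟩ := ZMod.natCast_zmod_surjective t
  rw [map_natCast, ← Nat.cast_pow, ← Nat.cast_mul, ZMod.natCast_eq_zero_iff,
    ZMod.natCast_eq_zero_iff, pow_add, mul_comm (p ^ s)]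
  exact Nat.mul_dvd_mul_iff_left (pow_pos hp.out.pos k)

theorem isUnit_of_not_mem_primeIdeal {r : ℕ} (x : ZMod (p ^ r)) (hx : x ∉ primeIdeal p r) :
    IsUnit x := by
  obtain ⟨x, rfl⟩ := ZMod.natCast_zmod_surjective x
  rw [ZMod.isUnit_iff_coprime]
  refine Nat.Coprime.pow_right _ (Nat.Coprime.symm ((Nat.Prime.coprime_iff_not_dvd hp.out).mpr ?_))
  rintro ⟨y, rfl⟩
  exact hx (Ideal.mem_span_singleton.mpr ⟨y, by push_cast; rfl⟩)

theorem one_not_mem_primeIdeal {r : ℕ} (hr : 1 ≤ r) : (1 : ZMod (p ^ r)) ∉ primeIdeal p r := by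
  intro h
  obtain ⟨y, hy⟩ := Ideal.mem_span_singleton.mp h
  have := congrArg (ZMod.castHom (dvd_pow_self p (by omega : r ≠ 0)) (ZMod p)) hy
  rw [map_one, map_mul, map_natCast, ZMod.natCast_self, zero_mul] at this
  exact one_ne_zero this

theorem isUnit_one_add_of_mem_primeIdeal {r : ℕ} (hr : 1 ≤ r) (x : ZMod (p ^ r))
    (hx : x ∈ primeIdeal p r) : IsUnit (1 + x) :=
  isUnit_of_not_mem_primeIdeal _ fun h =>
    one_not_mem_primeIdeal hr (by simpa using (primeIdeal p r).sub_mem h hx)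

/-- Multiplication by `p` as a map onto the ideal `pR`. -/
def mulPrime (p r : ℕ) : ZMod (p ^ r) →+ primeIdeal p r where
  toFun x := ⟨p * x, Ideal.mul_mem_right _ _ (Ideal.mem_span_singleton_self _)⟩
  map_zero' := by simp
  map_add' x y := by ext; simp [mul_add]

theorem mulPrime_surjective (p r : ℕ) : Function.Surjective (mulPrime p r) := by
  rintro ⟨x, hx⟩
  obtain ⟨y, rfl⟩ := Ideal.mem_span_singleton.mp hx
  exact ⟨y, rfl⟩

/-- Multiplication by `p` and reduction modulo p^s have the same kernel on ℤ/p^(s+1), so their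
images have equal size. -/
theorem card_primeIdeal (s : ℕ) : Nat.card (primeIdeal p (s + 1)) = p ^ s := by
  have h1 := Nat.card_subtype_comp_mul_card (mulPrime p (s + 1)) (mulPrime_surjective p _) (· = 0)
  have h2 := Nat.card_subtype_comp_mul_card
    (ZMod.castHom (pow_dvd_pow p (Nat.le_add_right s 1)) (ZMod (p ^ s))).toAddMonoidHom
    (ZMod.castHom_surjective (pow_dvd_pow p (Nat.le_add_right s 1))) (· = 0)
  have h3 : ∀ x, mulPrime p (s + 1) x = 0 ↔
      (ZMod.castHom (pow_dvd_pow p (Nat.le_add_right s 1)) (ZMod (p ^ s))).toAddMonoidHom x = 0 := by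
    intro x
    rw [← Subtype.coe_inj]
    have := ZMod.pow_mul_eq_zero_iff s 1 x
    rw [pow_one] at this
    exact this
  simp only [h3, Nat.card_unique] at h1
  simp only [Nat.card_unique] at h2
  rw [← h2] at h1
  have hpos : 0 < Nat.card {x // (ZMod.castHom (pow_dvd_pow p (Nat.le_add_right s 1))
      (ZMod (p ^ s))).toAddMonoidHom x = 0} :=
    Nat.card_pos_iff.mpr ⟨⟨⟨0, map_zero _⟩⟩, inferInstance⟩
  simpa using Nat.eq_of_mul_eq_mul_left hpos h1

/-- The number of pairs of vectors of length `m` over `ℤ/pˢℤ` that are orthogonal. -/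
noncomputable def orthogonalCount (p m s : ℕ) : ℕ :=
  Nat.card {v : Fin m → ZMod (p ^ s) × ZMod (p ^ s) // ∑ i, (v i).1 * (v i).2 = 0}

theorem card_pow_mul_sum_eq_zero (m s k : ℕ) :
    Nat.card {v : Fin m → ZMod (p ^ (s + k)) × ZMod (p ^ (s + k)) //
      (p : ZMod (p ^ (s + k))) ^ k * ∑ i, (v i).1 * (v i).2 = 0} = p ^ (2 * k * m) * orthogonalCount p m s := by
  let f := ZMod.castHom (pow_dvd_pow p (Nat.le_add_right s k)) (ZMod (p ^ s))
  have hf : Function.Surjective f.toAddMonoidHom :=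
    ZMod.castHom_surjective (pow_dvd_pow p (Nat.le_add_right s k))
  have h := card_subtype_pairVecMap hf hf m fun v => ∑ i, (v i).1 * (v i).2 = 0
  have h3 : ∀ v : Fin m → ZMod (p ^ (s + k)) × ZMod (p ^ (s + k)),
      (p : ZMod (p ^ (s + k))) ^ k * ∑ i, (v i).1 * (v i).2 = 0 ↔
      ∑ i, (pairVecMap f.toAddMonoidHom f.toAddMonoidHom m v i).1 *
        (pairVecMap f.toAddMonoidHom f.toAddMonoidHom m v i).2 = 0 := by
    intro v
    rw [ZMod.pow_mul_eq_zero_iff, map_sum]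
    simp only [map_mul]
    rfl
  simp only [← h3, Nat.card_zmod] at h
  refine Nat.eq_of_mul_eq_mul_right
    (pow_pos (Nat.mul_pos (pow_pos hp.out.pos s) (pow_pos hp.out.pos s)) m) ?_
  rw [h, orthogonalCount]
  ring

/-- Writing x = px' and y = py', the equation becomes p² ∑ x'ᵢy'ᵢ = 0 modulo p^(s+2), that is,
orthogonality modulo p^s. -/
theorem hyperbolicCount_primeIdeal (m s : ℕ) :
    hyperbolicCount (primeIdeal p (s + 2)) m 0 = p ^ (2 * m) * orthogonalCount p m s := by
  have h := card_subtype_pairVecMap (mulPrime_surjective p (s + 2)) (mulPrime_surjective p (s + 2)) m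
    fun v => ∑ i, ((v i).1 : ZMod (p ^ (s + 2))) * (v i).2 = 0
  have h3 : ∀ v : Fin m → ZMod (p ^ (s + 2)) × ZMod (p ^ (s + 2)),
      ∑ i, ((pairVecMap (mulPrime p (s + 2)) (mulPrime p (s + 2)) m v i).1 : ZMod (p ^ (s + 2))) *
        (pairVecMap (mulPrime p (s + 2)) (mulPrime p (s + 2)) m v i).2 = 0 ↔
      (p : ZMod (p ^ (s + 2))) ^ 2 * ∑ i, (v i).1 * (v i).2 = 0 := by
    intro v
    rw [Finset.mul_sum]
    refine Eq.congr_left (Finset.sum_congr rfl fun i _ => ?_)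
    change (p * (v i).1 : ZMod (p ^ (s + 2))) * (p * (v i).2) = _
    ring
  simp only [h3, card_pow_mul_sum_eq_zero, card_primeIdeal, Nat.card_zmod] at h
  refine Nat.eq_of_mul_eq_mul_left
    (pow_pos (Nat.mul_pos (pow_pos hp.out.pos (s + 2)) (pow_pos hp.out.pos (s + 2))) m) ?_
  refine h.symm.trans ?_
  ring

theorem card_orthogonal_mem_primeIdeal (m s : ℕ) :
    Nat.card {v : Fin m → ZMod (p ^ (s + 1)) × ZMod (p ^ (s + 1)) //
      ∑ i, (v i).1 * (v i).2 = 0 ∧ ∀ i, (v i).1 ∈ primeIdeal p (s + 1)} =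
      p ^ m * orthogonalCount p m s := by
  have h := card_subtype_pairVecMap (mulPrime_surjective p (s + 1))
    (f := mulPrime p (s + 1)) (g := AddMonoidHom.id (ZMod (p ^ (s + 1)))) Function.surjective_id m
    fun v => ∑ i, ((v i).1 : ZMod (p ^ (s + 1))) * (v i).2 = 0
  have h3 : ∀ v : Fin m → ZMod (p ^ (s + 1)) × ZMod (p ^ (s + 1)),
      ∑ i, ((pairVecMap (mulPrime p (s + 1)) (AddMonoidHom.id _) m v i).1 : ZMod (p ^ (s + 1))) *
        (pairVecMap (mulPrime p (s + 1)) (AddMonoidHom.id _) m v i).2 = 0 ↔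
      (p : ZMod (p ^ (s + 1))) ^ 1 * ∑ i, (v i).1 * (v i).2 = 0 := by
    intro v
    rw [Finset.mul_sum]
    refine Eq.congr_left (Finset.sum_congr rfl fun i _ => ?_)
    change (p * (v i).1 : ZMod (p ^ (s + 1))) * (v i).2 = _
    ring
  have e : {v : Fin m → ZMod (p ^ (s + 1)) × ZMod (p ^ (s + 1)) //
      ∑ i, (v i).1 * (v i).2 = 0 ∧ ∀ i, (v i).1 ∈ primeIdeal p (s + 1)} ≃
      {v : Fin m → primeIdeal p (s + 1) × ZMod (p ^ (s + 1)) //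
        ∑ i, ((v i).1 : ZMod (p ^ (s + 1))) * (v i).2 = 0} :=
    { toFun := fun v => ⟨fun i => (⟨(v.1 i).1, v.2.2 i⟩, (v.1 i).2), v.2.1⟩
      invFun := fun v => ⟨fun i => ((v.1 i).1, (v.1 i).2), v.2, fun i => (v.1 i).1.2⟩
      left_inv := fun _ => rfl
      right_inv := fun _ => rfl }
  simp only [h3, card_pow_mul_sum_eq_zero, card_primeIdeal, Nat.card_zmod] at h
  rw [Nat.card_congr e]
  refine Nat.eq_of_mul_eq_mul_left
    (pow_pos (Nat.mul_pos (pow_pos hp.out.pos (s + 1)) (pow_pos hp.out.pos (s + 1))) m) ?_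
  refine h.symm.trans ?_
  ring

/-- If `x` has a unit coordinate, y ↦ ∑ xᵢyᵢ is onto, so its kernel has index p^(s+1). There are
p^((s+1)m) - p^(sm) such `x`; the subtracted term is moved across to stay in ℕ. -/
theorem card_orthogonal_not_mem_primeIdeal (m s : ℕ) :
    Nat.card {v : Fin m → ZMod (p ^ (s + 1)) × ZMod (p ^ (s + 1)) //
      ∑ i, (v i).1 * (v i).2 = 0 ∧ ¬ ∀ i, (v i).1 ∈ primeIdeal p (s + 1)} * p ^ (s + 1) +
      p ^ (s * m) * p ^ ((s + 1) * m) = p ^ ((s + 1) * m) * p ^ ((s + 1) * m) := by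
  classical
  have e : {v : Fin m → ZMod (p ^ (s + 1)) × ZMod (p ^ (s + 1)) //
      ∑ i, (v i).1 * (v i).2 = 0 ∧ ¬ ∀ i, (v i).1 ∈ primeIdeal p (s + 1)} ≃
      Σ x : {x : Fin m → ZMod (p ^ (s + 1)) // ¬ ∀ i, x i ∈ primeIdeal p (s + 1)},
        {y : Fin m → ZMod (p ^ (s + 1)) // ∑ i, x.1 i * y i = 0} :=
    { toFun := fun v => ⟨⟨fun i => (v.1 i).1, v.2.2⟩, ⟨fun i => (v.1 i).2, v.2.1⟩⟩
      invFun := fun w => ⟨fun i => (w.1.1 i, w.2.1 i), w.2.2, w.1.2⟩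
      left_inv := fun _ => rfl
      right_inv := fun _ => rfl }
  have hy : ∀ x : {x : Fin m → ZMod (p ^ (s + 1)) // ¬ ∀ i, x i ∈ primeIdeal p (s + 1)},
      Nat.card {y : Fin m → ZMod (p ^ (s + 1)) // ∑ i, x.1 i * y i = 0} * p ^ (s + 1) =
        p ^ ((s + 1) * m) := by
    rintro ⟨x, hx⟩
    let f : (Fin m → ZMod (p ^ (s + 1))) →+ ZMod (p ^ (s + 1)) :=
      { toFun := fun y => ∑ i, x i * y i
        map_zero' := by simp
        map_add' := fun y z => by simp [mul_add, Finset.sum_add_distrib] }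
    have hf : Function.Surjective f := by
      intro t
      push Not at hx
      obtain ⟨i, hi⟩ := hx
      obtain ⟨w, hw⟩ := (isUnit_of_not_mem_primeIdeal _ hi).exists_right_inv
      refine ⟨Pi.single i (w * t), ?_⟩
      change ∑ j, x j * (Pi.single i (w * t) : Fin m → ZMod (p ^ (s + 1))) j = t
      rw [Finset.sum_eq_single i (fun j _ hj => by simp [hj]) (by simp), Pi.single_eq_same, ← mul_assoc,
        hw, one_mul]
    have h := Nat.card_subtype_comp_mul_card f hf (· = 0)
    simp only [Nat.card_zmod, Nat.card_fun, Nat.card_unique, Nat.card_fin, mul_one, ← pow_mul] at h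
    exact h
  have hx : Nat.card {x : Fin m → ZMod (p ^ (s + 1)) // ¬ ∀ i, x i ∈ primeIdeal p (s + 1)} +
      p ^ (s * m) = p ^ ((s + 1) * m) := by
    have e' : {x : Fin m → ZMod (p ^ (s + 1)) // ∀ i, x i ∈ primeIdeal p (s + 1)} ≃
        (Fin m → primeIdeal p (s + 1)) :=
      { toFun := fun x i => ⟨x.1 i, x.2 i⟩
        invFun := fun x => ⟨fun i => x i, fun i => (x i).2⟩
        left_inv := fun _ => rfl
        right_inv := fun _ => rfl }
    have h1 : p ^ (s * m) =
        Nat.card {x : Fin m → ZMod (p ^ (s + 1)) // ∀ i, x i ∈ primeIdeal p (s + 1)} := by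
      rw [Nat.card_congr e', Nat.card_fun, card_primeIdeal, Nat.card_fin, pow_mul]
    rw [h1, add_comm, ← Nat.card_sum, Nat.card_congr (Equiv.sumCompl _), Nat.card_fun, Nat.card_zmod,
      Nat.card_fin, pow_mul]
  rw [Nat.card_congr e, Nat.card_sigma, Finset.sum_mul, Finset.sum_congr rfl fun x _ => hy x,
    Finset.sum_const, smul_eq_mul, Finset.card_univ, ← Nat.card_eq_fintype_card, ← add_mul, hx]

/-- Split according to whether all coordinates of `x` lie in the prime ideal; if they do, dividing
`x` by `p` lowers the level by one. -/
theorem orthogonalCount_succ (m s : ℕ) :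
    orthogonalCount p m (s + 1) * p ^ (s + 1) + p ^ (s * m) * p ^ ((s + 1) * m) =
      p ^ ((s + 1) * m) * p ^ ((s + 1) * m) + p ^ m * orthogonalCount p m s * p ^ (s + 1) := by
  classical
  rw [← card_orthogonal_not_mem_primeIdeal, ← card_orthogonal_mem_primeIdeal, add_right_comm, ← add_mul,
    ← Nat.card_sum]
  congr 2
  refine Nat.card_congr (Equiv.trans ?_ (Equiv.sumComm _ _))
  exact ((Equiv.sumCompl fun v : {v : Fin m → ZMod (p ^ (s + 1)) × ZMod (p ^ (s + 1)) //
    ∑ i, (v i).1 * (v i).2 = 0} => ∀ i, (v.1 i).1 ∈ primeIdeal p (s + 1)).symm).trans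
    (Equiv.sumCongr (Equiv.subtypeSubtypeEquivSubtypeInter _
        fun v : Fin m → ZMod (p ^ (s + 1)) × ZMod (p ^ (s + 1)) =>
        ∀ i, (v i).1 ∈ primeIdeal p (s + 1))
      (Equiv.subtypeSubtypeEquivSubtypeInter _ fun v : Fin m → ZMod (p ^ (s + 1)) × ZMod (p ^ (s + 1)) =>
        ¬ ∀ i, (v i).1 ∈ primeIdeal p (s + 1)))

/-- The factor `p` avoids a negative exponent at s = 0. Geometric sums, unlike q-numbers, also cover
the ratio 1 at l = 0, which gives the case n = 4. -/
theorem prime_mul_orthogonalCount (l s : ℕ) :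
    (p : ℚ) * orthogonalCount p (l + 1) s =
      (p : ℚ) ^ ((l + 1) * s + 1) * ∑ i ∈ Finset.range (s + 1), ((p : ℚ) ^ l) ^ i -
        (p : ℚ) ^ ((l + 1) * s) * ∑ i ∈ Finset.range s, ((p : ℚ) ^ l) ^ i := by
  have hp0 : (p : ℚ) ≠ 0 := by exact_mod_cast hp.out.ne_zero
  induction s with
  | zero =>
    have : orthogonalCount p (l + 1) 0 = 1 := by
      have : Subsingleton (ZMod (p ^ 0)) := by rw [pow_zero]; infer_instance
      rw [orthogonalCount, Nat.card_eq_one_iff_unique]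
      exact ⟨inferInstance, ⟨⟨0, Subsingleton.elim _ _⟩⟩⟩
    simp [this]
  | succ s ih =>
    have h : ((_ : ℕ) : ℚ) = (_ : ℕ) := congrArg _ (orthogonalCount_succ (p := p) (l + 1) s)
    push_cast at h
    rw [Finset.sum_range_succ _ (s + 1)]
    rw [Finset.sum_range_succ _ s] at ih ⊢
    set G := ∑ i ∈ Finset.range s, ((p : ℚ) ^ l) ^ i
    have h1 : ((p : ℚ) ^ (s + 1)) ≠ 0 := pow_ne_zero _ hp0
    refine mul_left_cancel₀ h1 ?_
    have e1 : (p : ℚ) ^ (s * (l + 1)) = p ^ s * (p ^ l) ^ s := by rw [← pow_mul, ← pow_add]; ring_nf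
    have e2 : (p : ℚ) ^ ((s + 1) * (l + 1)) = p ^ s * (p ^ l) ^ s * p * p ^ l := by
      rw [← pow_mul, ← pow_add, ← pow_succ, ← pow_add]; ring_nf
    rw [mul_comm (l + 1) s] at ih
    rw [mul_comm (l + 1) (s + 1), pow_succ _ ((s + 1) * (l + 1))]
    rw [pow_succ _ (s * (l + 1))] at ih
    rw [e1] at ih h
    rw [e2] at h ⊢
    simp only [pow_succ _ s, pow_succ _ l] at *
    linear_combination (p : ℚ) * h + (p : ℚ) ^ l * p * (p ^ s * p) * ih

end PrimePower

/-! ### The zero tuple, the values of σ, and the final count. -/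

section Assembly

theorem card_cycles_eq_add_ite {A : Type*} [CommRing A] [Finite A] {ε : A} (k : ℕ)
    [Decidable ((-1 : A) ^ k = ε)] :
    quiddityCount A (2 * k) ε =
      Nat.card {b : Fin (2 * k) → A // IsQuiddityCycle ε b ∧ b ≠ 0} + if (-1) ^ k = ε then 1 else 0 := by
  classical
  have h0 : IsQuiddityCycle ε (0 : Fin (2 * k) → A) ↔ (-1) ^ k = ε := by
    rw [IsQuiddityCycle, etaProd_zero]
    refine ⟨fun h => ?_, fun h => by rw [h]⟩
    simpa using congrFun (congrFun h 0) 0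
  have h1 : Nat.card {b : Fin (2 * k) → A // IsQuiddityCycle ε b ∧ b = 0} =
      if (-1) ^ k = ε then 1 else 0 := by
    split_ifs with h
    · rw [Nat.card_eq_one_iff_unique]
      exact ⟨⟨fun x y => Subtype.ext (x.2.2.trans y.2.2.symm)⟩, ⟨⟨0, h0.mpr h, rfl⟩⟩⟩
    · exact Nat.card_eq_zero.mpr (Or.inl ⟨fun x => h (h0.mp (x.2.2 ▸ x.2.1))⟩)
  rw [← h1, add_comm, ← Nat.card_sum]
  exact Nat.card_congr ((Equiv.sumCompl fun v : {b : Fin (2 * k) → A // IsQuiddityCycle ε b} =>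
    v.1 = 0).symm.trans
    (Equiv.sumCongr (Equiv.subtypeSubtypeEquivSubtypeInter _ fun v : Fin (2 * k) → A => v = 0)
      (Equiv.subtypeSubtypeEquivSubtypeInter _ fun v : Fin (2 * k) → A => ¬ v = 0)))

theorem IsQuiddityCycle.eq_zero_of_two {A : Type*} [CommRing A] {ε : A} {c : Fin 2 → A}
    (h : IsQuiddityCycle ε c) : c = 0 := by
  have hP : etaProd c = !![c 0 * c 1 - 1, -c 0; c 1, -1] := by
    simp [etaProd, eta, List.ofFn_succ, sub_eq_add_neg]
  rw [IsQuiddityCycle, hP] at h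
  have e0 := congrFun (congrFun h 0) 1
  have e1 := congrFun (congrFun h 1) 0
  simp at e0 e1
  funext i
  fin_cases i
  · exact e0
  · exact e1

/-- Modulo `N` products of two elements of the ideal vanish, but -2 does not. It is applied with N =
p for odd `p` and with N = 4 for p = 2. -/
theorem hyperbolicCount_neg_two_eq_zero {p r N : ℕ} (m : ℕ)
    (h1 : N ∣ p ^ r) (h2 : N ∣ p ^ 2) (h3 : ¬ N ∣ 2) :
    hyperbolicCount (primeIdeal p r) m (-2) = 0 := by
  refine Nat.card_eq_zero.mpr (Or.inl ⟨fun ⟨v, hv⟩ => h3 ?_⟩)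
  have h := congrArg (ZMod.castHom h1 (ZMod N)) hv
  rw [map_sum, Finset.sum_eq_zero, map_neg, eq_comm, neg_eq_zero,
    show (2 : ZMod (p ^ r)) = ((2 : ℕ) : ZMod (p ^ r)) by norm_num, map_natCast,
    ZMod.natCast_eq_zero_iff] at h
  · exact h
  · intro i _
    obtain ⟨x, hx⟩ := Ideal.mem_span_singleton.mp (v i).1.2
    obtain ⟨y, hy⟩ := Ideal.mem_span_singleton.mp (v i).2.2
    have hN : ((p : ZMod N)) ^ 2 = 0 := by
      rw [← Nat.cast_pow, ZMod.natCast_eq_zero_iff]; exact h2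
    rw [hx, hy, map_mul, map_mul, map_mul, map_natCast]
    linear_combination (ZMod.castHom h1 (ZMod N) x * ZMod.castHom h1 (ZMod N) y) * hN

variable {p : ℕ} [hp : Fact p.Prime]

theorem quiddityCount_eq_zpow (s m : ℕ) {ε : ZMod (p ^ (s + 1))} (hε : ε * ε = 1) :
    (quiddityCount (ZMod (p ^ (s + 1))) (2 * (m + 1)) ε : ℚ) =
      (Nat.card {b : Fin (2 * (m + 1)) → ZMod (p ^ (s + 1)) ⧸ primeIdeal p (s + 1) //
        IsQuiddityCycle (Ideal.Quotient.mk (primeIdeal p (s + 1)) ε) b ∧ b ≠ 0} : ℚ) *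
      (p : ℚ) ^ ((((s + 1 : ℕ) : ℤ) - 1) * (((2 * (m + 1) : ℕ) : ℤ) - 3)) +
      quiddityCountIn (primeIdeal p (s + 1)) (2 * (m + 1)) ε := by
  rcases m with _ | m
  -- For n = 2 the exponent is -(r-1), but its coefficient is 0: the only possible cycle of length 2
  -- is the zero tuple.
  · have h0 : Nat.card {b : Fin (2 * (0 + 1)) → ZMod (p ^ (s + 1)) ⧸ primeIdeal p (s + 1) //
        IsQuiddityCycle (Ideal.Quotient.mk (primeIdeal p (s + 1)) ε) b ∧ b ≠ 0} = 0 :=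
      Nat.card_eq_zero.mpr (Or.inl ⟨fun b => b.2.2 (IsQuiddityCycle.eq_zero_of_two b.2.1)⟩)
    rw [h0, Nat.cast_zero, zero_mul, quiddityCount, quiddityCountIn]
    refine Eq.trans (congrArg Nat.cast (Nat.card_congr (Equiv.subtypeEquivRight
      fun (c : Fin 2 → ZMod (p ^ (s + 1))) =>
        ⟨fun h => ⟨h, fun i => ?_⟩, fun h => h.1⟩))) (zero_add _).symm
    have : c i = 0 := congrFun (IsQuiddityCycle.eq_zero_of_two h) i
    rw [this]; exact Ideal.zero_mem _
  · have h := quiddityCount_eq (I := primeIdeal p (s + 1)) isUnit_of_not_mem_primeIdeal hε (2 * m + 1)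
    have hexp : (((s + 1 : ℕ) : ℤ) - 1) * (((2 * (m + 1 + 1) : ℕ) : ℤ) - 3) =
        ((s * (2 * m + 1) : ℕ) : ℤ) := by push_cast; ring
    rw [hexp, zpow_natCast, pow_mul]
    rw [card_primeIdeal] at h
    exact_mod_cast h

theorem quiddityCountIn_neg_eq_zero (s m N : ℕ) (h1 : N ∣ p ^ (s + 1)) (h2 : N ∣ p ^ 2)
    (h3 : ¬ N ∣ 2) :
    quiddityCountIn (primeIdeal p (s + 1)) (2 * (m + 1)) (-((-1) ^ (m + 1))) = 0 := by
  have hs : (-1 : ZMod (p ^ (s + 1))) ^ (m + 1) * (-1) ^ (m + 1) = 1 := by rw [← mul_pow]; simp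
  rw [quiddityCountIn_eq_hyperbolicCount (isUnit_one_add_of_mem_primeIdeal (by omega)) m
    (by linear_combination hs)]
  rw [show (-1 : ZMod (p ^ (s + 1))) ^ (m + 1) * -((-1) ^ (m + 1)) - 1 = -2 by
    linear_combination -hs]
  exact hyperbolicCount_neg_two_eq_zero m h1 h2 h3

theorem sigmaCount_eq_hyperbolicCount (s m : ℕ) :
    sigmaCount p (s + 1) (2 * (m + 1)) = hyperbolicCount (primeIdeal p (s + 1)) m 0 := by
  have hs : (-1 : ZMod (p ^ (s + 1))) ^ (m + 1) * (-1) ^ (m + 1) = 1 := by rw [← mul_pow]; simp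
  rw [sigmaCount, Nat.mul_div_cancel_left _ two_pos,
    quiddityCountIn_eq_hyperbolicCount (isUnit_one_add_of_mem_primeIdeal (by omega)) m hs, hs, sub_self]

theorem sigmaCount_one (m : ℕ) : sigmaCount p 1 (2 * (m + 1)) = 1 := by
  rw [sigmaCount_eq_hyperbolicCount]
  have h : Nat.card (primeIdeal p (0 + 1)) = 1 := by rw [card_primeIdeal, pow_zero]
  have := (Nat.card_eq_one_iff_unique.mp h).1
  rw [hyperbolicCount, Nat.card_eq_one_iff_unique]
  exact ⟨inferInstance, ⟨⟨0, by simp⟩⟩⟩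

theorem sigmaCount_two (s : ℕ) : sigmaCount p (s + 1) 2 = 1 := by
  rw [sigmaCount_eq_hyperbolicCount s 0, hyperbolicCount]
  simp

theorem prime_mul_sigmaCount (s l : ℕ) :
    (p : ℚ) * sigmaCount p (s + 2) (2 * (l + 2)) =
      (p : ℚ) ^ ((l + 1) * (s + 2) + 1) * ∑ i ∈ Finset.range (s + 1), ((p : ℚ) ^ l) ^ i -
        (p : ℚ) ^ ((l + 1) * (s + 2)) * ∑ i ∈ Finset.range s, ((p : ℚ) ^ l) ^ i := by
  rw [sigmaCount_eq_hyperbolicCount (s + 1) (l + 1), hyperbolicCount_primeIdeal]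
  push_cast
  linear_combination (p : ℚ) ^ (2 * (l + 1)) * prime_mul_orthogonalCount (p := p) l s

theorem sigmaCount_four (s : ℕ) :
    (sigmaCount p (s + 1) 4 : ℚ) =
      (((s + 1 : ℕ) : ℚ) - 1) * (p : ℚ) ^ (s + 1) - (((s + 1 : ℕ) : ℚ) - 2) * (p : ℚ) ^ s := by
  have hp0 : (p : ℚ) ≠ 0 := by exact_mod_cast hp.out.ne_zero
  rcases s with _ | s
  · have := sigmaCount_one (p := p) 1
    norm_num at this ⊢
    exact_mod_cast this
  · have h := prime_mul_sigmaCount (p := p) s 0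
    simp at h
    refine mul_left_cancel₀ hp0 (h.trans ?_)
    push_cast
    ring

theorem sigmaCount_of_four_lt (s l : ℕ) :
    (sigmaCount p (s + 1) (2 * (l + 3)) : ℚ) =
      (p : ℚ) ^ ((((2 * (l + 3) : ℕ) : ℤ) / 2 - 1) * ((s + 1 : ℕ) : ℤ))
          * qNumber ((p : ℚ) ^ (((2 * (l + 3) : ℕ) : ℤ) / 2 - 2)) (((s + 1 : ℕ) : ℤ) - 1)
        - (p : ℚ) ^ ((((2 * (l + 3) : ℕ) : ℤ) / 2 - 1) * ((s + 1 : ℕ) : ℤ) - 1)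
          * qNumber ((p : ℚ) ^ (((2 * (l + 3) : ℕ) : ℤ) / 2 - 2)) (((s + 1 : ℕ) : ℤ) - 2) := by
  have hp0 : (p : ℚ) ≠ 0 := by exact_mod_cast hp.out.ne_zero
  have hq1 : (p : ℚ) ^ (l + 1) ≠ 1 := (one_lt_pow₀ (by exact_mod_cast hp.out.one_lt) (by omega)).ne'
  have hdiv : ((2 * (l + 3) : ℕ) : ℤ) / 2 = l + 3 := by push_cast; omega
  have hq : (p : ℚ) ^ ((l : ℤ) + 3 - 2) = p ^ (l + 1) := by
    rw [← zpow_natCast]; congr 1; push_cast; ring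
  have hm : (p : ℚ) ^ (((l : ℤ) + 3 - 1) * ((s + 1 : ℕ) : ℤ)) = p ^ ((l + 2) * (s + 1)) := by
    rw [← zpow_natCast]; congr 1; push_cast; ring
  rw [hdiv, hq, zpow_sub_one₀ hp0, hm]
  rcases s with _ | s
  -- For r = 1 the formula involves [0]_q = 0 and [-1]_q = -1/q, and it evaluates to 1.
  · rw [sigmaCount_one (p := p) (l + 2)]
    have h1 : (p : ℚ) ^ (l + 1) - 1 ≠ 0 := sub_ne_zero.mpr hq1
    have h2 : qNumber ((p : ℚ) ^ (l + 1)) (((0 + 1 : ℕ) : ℤ) - 1) = 0 := by simp [qNumber]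
    have h3 : qNumber ((p : ℚ) ^ (l + 1)) (((0 + 1 : ℕ) : ℤ) - 2) = -((p : ℚ) ^ (l + 1))⁻¹ := by
      rw [qNumber, show (((0 + 1 : ℕ) : ℤ) - 2) = -1 by norm_num, zpow_neg_one]
      field_simp
      ring
    rw [h2, h3]
    field_simp
    push_cast
    ring
  · have hG : ∀ k : ℕ, qNumber ((p : ℚ) ^ (l + 1)) (k : ℤ) =
        ∑ i ∈ Finset.range k, ((p : ℚ) ^ (l + 1)) ^ i := fun k => by
      rw [qNumber, zpow_natCast, geom_sum_eq hq1]
    rw [show ((s + 1 + 1 : ℕ) : ℤ) - 1 = ((s + 1 : ℕ) : ℤ) by push_cast; ring,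
      show ((s + 1 + 1 : ℕ) : ℤ) - 2 = (s : ℤ) by push_cast; ring, hG, hG]
    have h := prime_mul_sigmaCount (p := p) s (l + 1)
    refine mul_left_cancel₀ hp0 (h.trans ?_)
    field_simp
    ring

theorem two_not_mem_primeIdeal {r : ℕ} (hr : 1 ≤ r) (h2 : 2 < p) : (2 : ZMod (p ^ r)) ∉ primeIdeal p r := by
  intro h
  obtain ⟨y, hy⟩ := Ideal.mem_span_singleton.mp h
  have := congrArg (ZMod.castHom (dvd_pow_self p (by omega : r ≠ 0)) (ZMod p)) hy
  rw [map_mul, map_natCast, ZMod.natCast_self, zero_mul,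
    show (2 : ZMod (p ^ r)) = ((2 : ℕ) : ZMod (p ^ r)) by norm_num, map_natCast,
    ZMod.natCast_eq_zero_iff] at this
  exact absurd (Nat.le_of_dvd two_pos this) (by omega)

end Assembly

theorem mainTheorem2 (p r n : ℕ) (hp : p.Prime) (hr : 1 ≤ r) (hn : 1 < n) (hn_even : Even n)
    (ε : ZMod (p ^ r)) (hε : ε = 1 ∨ ε = -1) :
    (ε = (-1) ^ (n / 2) →
      (quiddityCount (ZMod (p ^ r)) n ε : ℚ) =
        ((omegaCount p r n ε : ℚ) - 1) * (p : ℚ) ^ (((r : ℤ) - 1) * ((n : ℤ) - 3))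
          + (sigmaCount p r n : ℚ)) ∧
    (ε = -((-1) ^ (n / 2)) → 2 < p →
      (quiddityCount (ZMod (p ^ r)) n ε : ℚ) =
        (omegaCount p r n ε : ℚ) * (p : ℚ) ^ (((r : ℤ) - 1) * ((n : ℤ) - 3))) ∧
    (ε = -((-1) ^ (n / 2)) → p = 2 → 2 ≤ r →
      (quiddityCount (ZMod (p ^ r)) n ε : ℚ) =
        ((omegaCount p r n ε : ℚ) - 1) * (p : ℚ) ^ (((r : ℤ) - 1) * ((n : ℤ) - 3))) ∧
    (n = 2 → (sigmaCount p r n : ℚ) = 1) ∧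
    (n = 4 → (sigmaCount p r n : ℚ) =
      ((r : ℚ) - 1) * (p : ℚ) ^ r - ((r : ℚ) - 2) * (p : ℚ) ^ (r - 1)) ∧
    (4 < n → (sigmaCount p r n : ℚ) =
      (p : ℚ) ^ (((n : ℤ) / 2 - 1) * (r : ℤ))
          * qNumber ((p : ℚ) ^ ((n : ℤ) / 2 - 2)) ((r : ℤ) - 1)
        - (p : ℚ) ^ (((n : ℤ) / 2 - 1) * (r : ℤ) - 1)
          * qNumber ((p : ℚ) ^ ((n : ℤ) / 2 - 2)) ((r : ℤ) - 2)) := by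
  have : Fact p.Prime := ⟨hp⟩
  obtain ⟨s, rfl⟩ : ∃ s, r = s + 1 := ⟨r - 1, by omega⟩
  obtain ⟨m, rfl⟩ : ∃ m, n = 2 * (m + 1) := by
    obtain ⟨k, hk⟩ := hn_even
    exact ⟨k - 1, by omega⟩
  classical
  have hεε : ε * ε = 1 := by rcases hε with rfl | rfl <;> ring
  have hω : omegaCount p (s + 1) (2 * (m + 1)) ε = _ := card_cycles_eq_add_ite (m + 1)
  have hcount := quiddityCount_eq_zpow s m hεε
  have hdiv : 2 * (m + 1) / 2 = m + 1 := Nat.mul_div_cancel_left _ two_pos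
  rw [hdiv]
  refine ⟨?_, ?_, ?_, ?_, ?_, ?_⟩
  · rintro rfl
    rw [map_pow, map_neg, map_one, if_pos rfl] at hω
    rw [hcount, hω, sigmaCount, hdiv, map_pow, map_neg, map_one]
    push_cast
    ring
  · rintro rfl h2
    -- For odd `p`, 2 is not in the ideal, so the zero tuple is not a cycle modulo `I` and every
    -- cycle counted by ω is nonzero.
    have hne : (-1 : ZMod (p ^ (s + 1)) ⧸ primeIdeal p (s + 1)) ^ (m + 1) ≠
        Ideal.Quotient.mk (primeIdeal p (s + 1)) (-((-1) ^ (m + 1))) := by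
      intro h
      rw [← map_one (Ideal.Quotient.mk (primeIdeal p (s + 1))), ← map_neg, ← map_pow,
        Ideal.Quotient.mk_eq_mk_iff_sub_mem] at h
      refine two_not_mem_primeIdeal hr h2 ?_
      have hs : (-1 : ZMod (p ^ (s + 1))) ^ (m + 1) * (-1) ^ (m + 1) = 1 := by rw [← mul_pow]; simp
      have := (primeIdeal p (s + 1)).mul_mem_left ((-1) ^ (m + 1)) h
      rwa [show (-1 : ZMod (p ^ (s + 1))) ^ (m + 1) * ((-1) ^ (m + 1) - -(-1) ^ (m + 1)) = 2 by
        linear_combination 2 * hs] at this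
    rw [if_neg hne, add_zero] at hω
    rw [hcount, hω, quiddityCountIn_neg_eq_zero s m p (dvd_pow_self p (by omega))
      (dvd_pow_self p two_ne_zero) fun h => absurd (Nat.le_of_dvd two_pos h) (by omega)]
    simp
  · rintro rfl rfl hr2
    -- For p = 2 the signs agree modulo `I`, so ω counts the zero tuple although it has no lift;
    -- hence ω - 1 with no σ term.
    have heq : (-1 : ZMod (2 ^ (s + 1)) ⧸ primeIdeal 2 (s + 1)) ^ (m + 1) =
        Ideal.Quotient.mk (primeIdeal 2 (s + 1)) (-((-1) ^ (m + 1))) := by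
      rw [← map_one (Ideal.Quotient.mk (primeIdeal 2 (s + 1))), ← map_neg, ← map_pow,
        Ideal.Quotient.mk_eq_mk_iff_sub_mem, sub_neg_eq_add, ← two_mul]
      exact Ideal.mul_mem_right _ _ (Ideal.mem_span_singleton.mpr (by norm_num))
    rw [if_pos heq] at hω
    rw [hcount, hω, quiddityCountIn_neg_eq_zero s m (2 ^ 2) (pow_dvd_pow 2 hr2) dvd_rfl (by norm_num)]
    push_cast
    ring
  · intro h
    obtain rfl : m = 0 := by omega
    exact_mod_cast sigmaCount_two (p := p) s
  · intro h
    obtain rfl : m = 1 := by omega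
    exact sigmaCount_four s
  · intro h
    obtain ⟨l, rfl⟩ : ∃ l, m = l + 2 := ⟨m - 2, by omega⟩
    exact sigmaCount_of_four_lt s l
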